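/- Let $D$ be an oriented regular (virtual) link diagram: finitely many oriented, piecewise smooth, closed curves in the plane that meet themselves and each other only in finitely many transverse double points, the crossings, each of which is classical or virtual; at each classical crossing one of the two passages is the overpassing one. The directed universe $\vec U$ of $D$ has the classical crossings as vertices, the oriented arcs of $D$ from one passage of a classical crossing to the next as edges, and one free loop for each link component without classical crossings. A directed Euler system $C$ of $\vec U$ consists of one directed Euler circuit for each connected component of $\vec U$ (together with all the free loops). The looped interlacement graph $\mathcal L(D,C)$ has the classical crossings as vertices; two different vertices $v,w$ are adjacent iff they are interlaced, i.e. appear in the order $v\dots w\dots v\dots w$ on a circuit of $C$; the looped vertices are the negative crossings; the marked vertices are the crossings at which $C$ does not follow the incident link component(s); and the number of free loops of $\mathcal L(D,C)$ is the number of connected components of $\vec U$ (free loops included) minus one. The vertices carry arbitrary weights $\alpha,\beta$ in a commutative ring $R$, in which two elements $A,B$ are given as standard weights. A marked, weighted graph $G$ is the composition $F*H$ if $V(F)\cap V(H)$ consists of a single unlooped, unmarked vertex $a$ with weights $\alpha(a)=A$, $\beta(a)=B$ in both $F$ and $H$; $V(G)=(V(F)\cup V(H))\setminus\{a\}$, with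 loops, marks and weights inherited from $F$ and $H$; $E(G)=E(F-a)\cup E(H-a)\cup\{\{v,w\} : \{v,a\}\in E(F),\ \{a,w\}\in E(H)\}$; and the free loops of $G$ are those of $F$ together with those of $H$, no free loop being shared. Suppose $D$ contains a 2-tangle, i.e. there is a simple closed curve in the plane that meets $D$ in precisely four points, none of which is a crossing; a crossing is inside the tangle if it lies in a bounded component of the complement of this curve, and outside if it lies in the unbounded one. (1) For every directed Euler system $C$ of $\vec U$ (and all weights) there are marked, weighted graphs $F$ and $H$ with a common vertex $a$ such that $\mathcal L(D,C)=F*H$, $F-a$ is the subgraph of $\mathcal L(D,C)$ induced by the classical crossings outside the tangle, and $H-a$ is the subgraph of $\mathcal L(D,C)$ induced by the classical crossings inside the tangle. (2) There is a directed Euler system $C$ of $\vec U$ such that, for all weights and for all $F,H,a$ as in (1), at least one of $F,H$ has no marked vertex adjacent to $a$. -/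

import Mathlib

universe u v

noncomputable section

/-! ### Directed multigraphs with free loops, and directed Euler systems -/

/-- A directed graph in which loops and multiple edges are allowed, and which may also have
free loops (connected components with neither vertices nor edges). -/
structure FLDigraph where
  /-- vertices -/
  V : Type
  /-- edges -/
  E : Type
  /-- free loops -/
  L : Type
  /-- the initial vertex of an edge -/
  tail : E → V
  /-- the terminal vertex of an edge -/
  head : E → V

namespace FLDigraph

/-- The connected components, other than free loops, of the underlying undirected graph. -/
def Component (U : FLDigraph) : Type :=
  Quot fun x y : U.V => ∃ e : U.E, U.tail e = x ∧ U.head e = y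

/-- The connected component that contains a given vertex. -/
def component (U : FLDigraph) (x : U.V) : U.Component := Quot.mk _ x

/-- The number of connected components, free loops included. -/
def numComponents (U : FLDigraph) : ℕ := Nat.card U.Component + Nat.card U.L

/-- A directed Euler system: one directed Euler circuit for each connected component, i.e. a
cyclic sequence of edges, each one ending where the next one begins, that contains every edge of
the component exactly once and no other edge. (The free loops also belong to the system; as
they all do, this involves no choice.) -/
structure EulerSystem (U : FLDigraph) where
  /-- the Euler circuit of a component -/
  circuit : U.Component → Cycle U.E
  /-- every edge ends where the next one begins -/
  chain : ∀ c, (circuit c).Chain fun e f => U.head e = U.tail f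
  /-- no edge is repeated -/
  nodup : ∀ c, (circuit c).Nodup
  /-- the edges of the circuit are the edges of the component -/
  mem_iff : ∀ c e, e ∈ circuit c ↔ U.component (U.tail e) = c

namespace EulerSystem

variable {U : FLDigraph}

/-- Two vertices are interlaced if on some circuit they appear in the order `x … y … x … y`. -/
def Interlaced (C : U.EulerSystem) (x y : U.V) : Prop :=
  x ≠ y ∧ ∃ (c : U.Component) (l : List U.E),
    (l : Cycle U.E) = C.circuit c ∧ List.Sublist [x, y, x, y] (l.map U.tail)

theorem Interlaced.symm {C : U.EulerSystem} {x y : U.V} (h : C.Interlaced x y) :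
    C.Interlaced y x := by
  obtain ⟨hne, c, l, hl, hs⟩ := h
  refine ⟨hne.symm, c, ?_⟩
  have hs' : List.Sublist ([x] ++ [y, x, y]) (l.map U.tail) := hs
  obtain ⟨m₁, m₂, hm, h₁, h₂⟩ := List.append_sublist_iff.1 hs'
  obtain ⟨l₁, l₂, rfl, rfl, rfl⟩ := List.map_eq_append_iff.1 hm
  refine ⟨l₂ ++ l₁, ?_, ?_⟩
  · rw [← hl]
    exact Cycle.coe_eq_coe.2 List.isRotated_append
  · rw [List.map_append]
    exact List.Sublist.append h₂ h₁

/-- The edge `f` comes immediately after the edge `e` on a circuit of the system. -/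
def Follows (C : U.EulerSystem) (e f : U.E) : Prop :=
  ∃ (c : U.Component) (l : List U.E),
    ((e :: l : List U.E) : Cycle U.E) = C.circuit c ∧ (l ++ [e]).head? = some f

end EulerSystem

end FLDigraph

/-! ### Marked, weighted graphs and their compositions -/

/-- A finite marked, weighted graph whose vertices lie in a type `X` and whose weights lie in
`R`. Loops are recorded by the set of looped vertices; `Adj` is adjacency of different
vertices. Values of the weights off the vertex set have no meaning. -/
structure MarkedGraph (X : Type u) (R : Type v) where
  /-- the vertex set -/
  verts : Set X
  finite_verts : verts.Finite
  /-- adjacency of two different vertices -/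
  Adj : X → X → Prop
  adj_symm : ∀ {x y}, Adj x y → Adj y x
  adj_irrefl : ∀ x, ¬ Adj x x
  left_mem : ∀ {x y}, Adj x y → x ∈ verts
  /-- the looped vertices -/
  looped : Set X
  looped_subset : looped ⊆ verts
  /-- the marked vertices -/
  marked : Set X
  marked_subset : marked ⊆ verts
  /-- the number of free loops -/
  freeLoops : ℕ
  /-- the weights `α` -/
  wα : X → R
  /-- the weights `β` -/
  wβ : X → R

namespace MarkedGraph

variable {X : Type u} {R : Type v}

/-- The graph `G - a`. -/
def deleteVert (G : MarkedGraph X R) (a : X) : MarkedGraph X R where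
  verts := G.verts \ {a}
  finite_verts := G.finite_verts.subset Set.sdiff_subset
  Adj x y := G.Adj x y ∧ x ≠ a ∧ y ≠ a
  adj_symm h := ⟨G.adj_symm h.1, h.2.2, h.2.1⟩
  adj_irrefl x h := G.adj_irrefl x h.1
  left_mem h := ⟨G.left_mem h.1, h.2.1⟩
  looped := G.looped \ {a}
  looped_subset := Set.sdiff_subset_sdiff_left G.looped_subset
  marked := G.marked \ {a}
  marked_subset := Set.sdiff_subset_sdiff_left G.marked_subset
  freeLoops := G.freeLoops
  wα := G.wα
  wβ := G.wβ

/-- `K` is the subgraph of `G` induced by the vertices of `G` that lie in `S`, with the loops,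
marks and weights of `G`. (Free loops are not incident on any vertex, so a subgraph induced by
a set of vertices may have any part of them.) -/
structure IsInducedSubgraph (K G : MarkedGraph X R) (S : Set X) : Prop where
  verts_eq : K.verts = G.verts ∩ S
  adj_iff : ∀ x ∈ K.verts, ∀ y ∈ K.verts, (K.Adj x y ↔ G.Adj x y)
  looped_iff : ∀ x ∈ K.verts, (x ∈ K.looped ↔ x ∈ G.looped)
  marked_iff : ∀ x ∈ K.verts, (x ∈ K.marked ↔ x ∈ G.marked)
  wα_eq : ∀ x ∈ K.verts, K.wα x = G.wα x
  wβ_eq : ∀ x ∈ K.verts, K.wβ x = G.wβ x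
  freeLoops_le : K.freeLoops ≤ G.freeLoops

/-- `a` is an unlooped, unmarked vertex of `G` with the standard weights `A` and `B`. -/
structure IsStandardVertex (G : MarkedGraph X R) (A B : R) (a : X) : Prop where
  mem : a ∈ G.verts
  not_looped : a ∉ G.looped
  not_marked : a ∉ G.marked
  wα_eq : G.wα a = A
  wβ_eq : G.wβ a = B

/-- `G` is the composition `F ∗ H` along the vertex `a`, where `A` and `B` are the standard
weights. -/
structure IsComposition (G F H : MarkedGraph X R) (A B : R) (a : X) : Prop where
  inter_eq : F.verts ∩ H.verts = {a}
  left_standard : F.IsStandardVertex A B a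
  right_standard : H.IsStandardVertex A B a
  verts_eq : G.verts = (F.verts ∪ H.verts) \ {a}
  left_looped : ∀ x ∈ F.verts \ {a}, (x ∈ G.looped ↔ x ∈ F.looped)
  right_looped : ∀ x ∈ H.verts \ {a}, (x ∈ G.looped ↔ x ∈ H.looped)
  left_marked : ∀ x ∈ F.verts \ {a}, (x ∈ G.marked ↔ x ∈ F.marked)
  right_marked : ∀ x ∈ H.verts \ {a}, (x ∈ G.marked ↔ x ∈ H.marked)
  left_wα : ∀ x ∈ F.verts \ {a}, G.wα x = F.wα x
  right_wα : ∀ x ∈ H.verts \ {a}, G.wα x = H.wα x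
  left_wβ : ∀ x ∈ F.verts \ {a}, G.wβ x = F.wβ x
  right_wβ : ∀ x ∈ H.verts \ {a}, G.wβ x = H.wβ x
  adj_iff : ∀ x y, G.Adj x y ↔
    (F.deleteVert a).Adj x y ∨ (H.deleteVert a).Adj x y ∨
      (F.Adj x a ∧ H.Adj a y) ∨ (F.Adj y a ∧ H.Adj a x)
  freeLoops_eq : G.freeLoops = F.freeLoops + H.freeLoops

/-- No marked vertex of `G` is adjacent to `a`. -/
def NoMarkedNeighbor (G : MarkedGraph X R) (a : X) : Prop :=
  ∀ x ∈ G.marked, ¬ G.Adj x a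

end MarkedGraph

/-! ### Link diagrams -/

/-- The Euclidean plane. -/
abbrev Plane : Type := EuclideanSpace ℝ (Fin 2)

/-- The determinant of two plane vectors. -/
def planeDet (x y : Plane) : ℝ := x 0 * y 1 - x 1 * y 0

/-- An oriented regular (virtual) link diagram: finitely many oriented, piecewise smooth, closed
curves in the plane that meet themselves and each other only in finitely many transverse double
points, the crossings. Some crossings are classical, the others are virtual; at every classical
crossing one of the two passages is the overpassing one. -/
structure LinkDiagram where
  /-- the number of link components -/
  n : ℕ
  /-- the closed curves; the orientation is the direction of increasing parameter -/
  curve : Fin n → UnitAddCircle → Plane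
  continuous_curve : ∀ i, Continuous (curve i)
  /-- there is a finite set of break points, and the curve is continuously differentiable, up to
  the end points, on every closed interval without break points in its interior -/
  piecewise_smooth : ∀ i, ∃ s : Finset ℝ, ∀ a b : ℝ, 0 ≤ a → a < b → b ≤ 1 →
    (∀ t ∈ s, t ∉ Set.Ioo a b) →
      ContDiffOn ℝ 1 (fun t : ℝ => curve i (t : UnitAddCircle)) (Set.Icc a b)
  /-- only finitely many points of the plane are passed more than once -/
  finite_crossings : {x : Plane | ∃ p q : Fin n × UnitAddCircle,
    p ≠ q ∧ curve p.1 p.2 = x ∧ curve q.1 q.2 = x}.Finite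
  /-- no point is passed more than twice -/
  double : ∀ p q r : Fin n × UnitAddCircle, curve p.1 p.2 = curve q.1 q.2 →
    curve q.1 q.2 = curve r.1 r.2 → p = q ∨ q = r ∨ p = r
  /-- at a crossing both passages are differentiable, with linearly independent velocities (both
  derivatives are nonzero by this condition, hence they exist) -/
  transverse : ∀ p q : Fin n × UnitAddCircle, p ≠ q → curve p.1 p.2 = curve q.1 q.2 →
    planeDet (deriv (fun t : ℝ => curve p.1 (p.2 + (t : UnitAddCircle))) 0)
      (deriv (fun t : ℝ => curve q.1 (q.2 + (t : UnitAddCircle))) 0) ≠ 0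
  /-- the classical crossings -/
  classical : Set Plane
  classical_subset : classical ⊆ {x : Plane | ∃ p q : Fin n × UnitAddCircle,
    p ≠ q ∧ curve p.1 p.2 = x ∧ curve q.1 q.2 = x}
  /-- the overpassing passages (this matters only at classical crossings) -/
  overpass : Set (Fin n × UnitAddCircle)
  overpass_iff : ∀ p q : Fin n × UnitAddCircle, p ≠ q → curve p.1 p.2 = curve q.1 q.2 →
    curve p.1 p.2 ∈ classical → (p ∈ overpass ↔ q ∉ overpass)

namespace LinkDiagram

/-- A passage: a parameter value on one of the closed curves. -/
abbrev Passage (D : LinkDiagram) : Type := Fin D.n × UnitAddCircle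

/-- The point of the plane that belongs to a parameter value. -/
def pt (D : LinkDiagram) (p : D.Passage) : Plane := D.curve p.1 p.2

/-- The velocity of the curve at a parameter value. -/
def velocity (D : LinkDiagram) (p : D.Passage) : Plane :=
  deriv (fun t : ℝ => D.pt (p.1, p.2 + (t : UnitAddCircle))) 0

/-- The set of all crossings, classical and virtual. -/
def crossings (D : LinkDiagram) : Set Plane := {x | ∃ p q, p ≠ q ∧ D.pt p = x ∧ D.pt q = x}

/-- The negative crossings: the classical crossings at which the velocities of the overpassing
and the underpassing strand, in this order, form a negatively oriented basis of the plane. -/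
def negative (D : LinkDiagram) : Set Plane :=
  {x | x ∈ D.classical ∧ ∃ p q, D.pt p = x ∧ D.pt q = x ∧ p ∈ D.overpass ∧ q ∉ D.overpass ∧
    planeDet (D.velocity p) (D.velocity q) < 0}

/-- `D.IsArc p q`: following the orientation from the passage `p` of a classical crossing, the
first passage of a classical crossing that is reached is `q` (which is `p` itself if the link
component has no other one). Virtual crossings on the way are ignored. -/
def IsArc (D : LinkDiagram) (p q : D.Passage) : Prop :=
  D.pt p ∈ D.classical ∧ D.pt q ∈ D.classical ∧ q.1 = p.1 ∧
    ∃ s : ℝ, 0 < s ∧ s ≤ 1 ∧ q.2 = p.2 + (s : UnitAddCircle) ∧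
      ∀ r : ℝ, 0 < r → r < s → D.pt (p.1, p.2 + (r : UnitAddCircle)) ∉ D.classical

/-- The directed universe: the vertices are the classical crossings, the edges are the arcs
from one passage of a classical crossing to the next, and there is a free loop for each link
component without classical crossings. -/
def directedUniverse (D : LinkDiagram) : FLDigraph where
  V := D.classical
  E := {e : D.Passage × D.Passage // D.IsArc e.1 e.2}
  L := {i : Fin D.n // ∀ t, D.pt (i, t) ∉ D.classical}
  tail e := ⟨D.pt e.1.1, e.2.1⟩
  head e := ⟨D.pt e.1.2, e.2.2.1⟩

/-- A directed Euler system for the universe of `D`. -/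
abbrev EulerSystem (D : LinkDiagram) : Type := D.directedUniverse.EulerSystem

/-- The marked crossings: those at which the Euler system does not follow the incident link
component(s), that is, where some edge of a circuit arrives through one passage of the crossing
and the next edge leaves through the other passage. -/
def markedCrossings (D : LinkDiagram) (C : D.EulerSystem) : Set Plane :=
  {x | ∃ e f : D.directedUniverse.E, C.Follows e f ∧ D.pt e.1.2 = x ∧ e.1.2 ≠ f.1.1}

theorem markedCrossings_subset (D : LinkDiagram) (C : D.EulerSystem) :
    D.markedCrossings C ⊆ D.classical := by
  rintro x ⟨e, f, -, rfl, -⟩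
  exact e.2.2.1

/-- The looped interlacement graph `𝓛(D, C)`, with weights `α`, `β` for the classical crossings.
Its vertices are the classical crossings, the marked vertices are the marked crossings, the
looped vertices are the negative crossings, and two vertices are adjacent if and only if they
are interlaced with respect to `C`. It has one free loop less than the universe of `D` has
connected components. -/
def interlacementGraph (D : LinkDiagram) (C : D.EulerSystem) {R : Type v} (α β : Plane → R) :
    MarkedGraph Plane R where
  verts := D.classical
  finite_verts := D.finite_crossings.subset D.classical_subset
  Adj x y := ∃ (hx : x ∈ D.classical) (hy : y ∈ D.classical), C.Interlaced ⟨x, hx⟩ ⟨y, hy⟩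
  adj_symm := fun ⟨hx, hy, h⟩ => ⟨hy, hx, h.symm⟩
  adj_irrefl := fun _ ⟨_, _, h⟩ => h.1 rfl
  left_mem := fun ⟨hx, _, _⟩ => hx
  looped := D.negative
  looped_subset := fun _ h => h.1
  marked := D.markedCrossings C
  marked_subset := D.markedCrossings_subset C
  freeLoops := D.directedUniverse.numComponents - 1
  wα := α
  wβ := β

/-- A 2-tangle in `D`, given by its boundary: a (topological) circle in the plane that intersects
`D` in precisely four points, none of which is a crossing. -/
structure Tangle (D : LinkDiagram) where
  /-- the boundary circle -/
  boundary : Set Plane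
  isCircle : ∃ J : UnitAddCircle → Plane,
    Continuous J ∧ Function.Injective J ∧ Set.range J = boundary
  four_points : (boundary ∩ Set.range D.pt).encard = 4
  not_crossing : Disjoint boundary D.crossings

namespace Tangle

variable {D : LinkDiagram}

/-- The points enclosed by the boundary circle: those that lie in a bounded component of its
complement. -/
def inside (T : D.Tangle) : Set Plane :=
  {x | x ∉ T.boundary ∧ Bornology.IsBounded (connectedComponentIn T.boundaryᶜ x)}

/-- The points outside the boundary circle. -/
def outside (T : D.Tangle) : Set Plane :=
  {x | x ∉ T.boundary ∧ ¬ Bornology.IsBounded (connectedComponentIn T.boundaryᶜ x)}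

end Tangle

/-- `F` and `H` decompose `𝓛(D, C)` along the tangle `T`: `𝓛(D, C) = F ∗ H` with common vertex
`a`, and `F - a`, `H - a` are the subgraphs of `𝓛(D, C)` induced by the crossings outside and
inside `T` respectively. -/
structure IsTangleDecomposition (D : LinkDiagram) (T : D.Tangle) (C : D.EulerSystem)
    {R : Type v} (A B : R) (α β : Plane → R) (F H : MarkedGraph Plane R) (a : Plane) : Prop where
  composition : (D.interlacementGraph C α β).IsComposition F H A B a
  outside_induced :
    (F.deleteVert a).IsInducedSubgraph (D.interlacementGraph C α β) T.outside
  inside_induced :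
    (H.deleteVert a).IsInducedSubgraph (D.interlacementGraph C α β) T.inside

end LinkDiagram

end

/-!
Every change of side along an Euler circuit uses another edge of a cut. Suppose that at most four
edges join a set `S` of vertices to its complement, that `v, v' ∈ S` and `w, w' ∉ S`, and that
`v, w` as well as `v', w'` are interlaced. The pair `v, w` accounts for four changes of side on
its circuit. If `v'` and `w'` lay on another circuit they would force two more there, and if `v`
and `w'` were not interlaced they would force two more on the same circuit. So the interlacements
across the cut form a complete bipartite graph, which is what a composition requires. The boundary
of a 2-tangle meets at most four arcs.

An Euler system is a permutation of the edges, each of which is sent to the one that follows it.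
Among these permutations choose one that departs from the link components at as few edges as
possible. Were two departures at interlaced crossings, then following the link components there
instead would split the circuit in two at the first crossing and join the two parts again at the
second one, and so give an Euler system with fewer departures.
-/

theorem exists_isRotated_of_sublist {α : Type*} {a b c d : α} {l : List α}
    (h : [a, b, c, d].Sublist l) : ∃ m n, l.IsRotated (a :: (m ++ c :: n)) ∧ b ∈ m ∧ d ∈ n := by
  obtain ⟨l₁, _, rfl, ha, hbcd⟩ := List.cons_sublist_iff.1 h
  obtain ⟨l₂, _, rfl, hb, hcd⟩ := List.cons_sublist_iff.1 hbcd
  obtain ⟨l₃, l₄, rfl, hc, hd⟩ := List.cons_sublist_iff.1 hcd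
  obtain ⟨s₁, t₁, rfl⟩ := List.append_of_mem ha
  obtain ⟨s₃, t₃, rfl⟩ := List.append_of_mem hc
  refine ⟨t₁ ++ l₂ ++ s₃, t₃ ++ l₄ ++ s₁, ?_, by simp [hb],
    by simp [List.singleton_sublist.1 hd]⟩
  simpa using List.isRotated_append (l := s₁) (l' := a :: (t₁ ++ l₂ ++ s₃ ++ c :: (t₃ ++ l₄)))

theorem exists_isRotated_sublist {α : Type*} {s l l' : List α} (h : s.Sublist l)
    (hl : l.IsRotated l') : ∃ s', s.IsRotated s' ∧ s'.Sublist l' := by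
  obtain ⟨n, hn, rfl⟩ := List.isRotated_iff_mod.1 hl
  rw [← List.take_append_drop n l] at h
  obtain ⟨s₁, s₂, rfl, h₁, h₂⟩ := List.sublist_append_iff.1 h
  exact ⟨s₂ ++ s₁, List.isRotated_append, by
    rw [List.rotate_eq_drop_append_take hn]; exact h₂.append h₁⟩

theorem eq_or_eq_of_isRotated_alternating {α : Type*} {x y : α} {l : List α}
    (h : [x, y, x, y].IsRotated l) : l = [x, y, x, y] ∨ l = [y, x, y, x] := by
  obtain ⟨n, hn, rfl⟩ := List.isRotated_iff_mod.1 h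
  simp only [List.length_cons, List.length_nil] at hn
  interval_cases n <;> simp

theorem sublist_left_of_notMem {α : Type*} {y : α} {s l m : List α} (hy : y ∉ m)
    (h : (s ++ [y]).Sublist (l ++ m)) : (s ++ [y]).Sublist l := by
  obtain ⟨s₁, s₂, hs, h₁, h₂⟩ := List.sublist_append_iff.1 h
  obtain rfl | ⟨t, z, rfl⟩ := s₂.eq_nil_or_concat
  · simpa [hs] using h₁
  · obtain ⟨-, rfl⟩ : s = s₁ ++ t ∧ y = z := by simpa [← List.append_assoc] using hs
    exact absurd (h₂.subset (by simp)) hy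

theorem sublist_right_of_notMem {α : Type*} {y : α} {s l m : List α} (hy : y ∉ l)
    (h : (y :: s).Sublist (l ++ m)) : (y :: s).Sublist m := by
  obtain ⟨s₁, s₂, hs, h₁, h₂⟩ := List.sublist_append_iff.1 h
  obtain _ | ⟨z, t⟩ := s₁
  · simpa [hs] using h₂
  · obtain ⟨rfl, -⟩ : y = z ∧ s = t ++ s₂ := by simpa using hs
    exact absurd (h₁.subset (by simp)) hy

theorem sublist_alternating_of_mem {α : Type*} {x y : α} {l m : List α} (hl : y ∈ l)
    (hm : y ∈ m) : [x, y, x, y].Sublist (x :: (l ++ x :: m)) :=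
  ((List.singleton_sublist.2 hl).append ((List.singleton_sublist.2 hm).cons_cons x)).cons_cons x

theorem mem_and_mem_or_sublist {α : Type*} {v v' w w' : α} {l m : List α} (hvw' : v ≠ w')
    (hl : w ∈ l) (hm : w ∈ m) (h : [w', v', w'].Sublist (v :: (l ++ v :: m))) :
    (w' ∈ l ∧ w' ∈ m) ∨ [v, w', v', w', v, w].Sublist (v :: (l ++ v :: m)) ∨
      [v, w, v, w', v', w'].Sublist (v :: (l ++ v :: m)) := by
  replace h := sublist_right_of_notMem (l := [v]) (by simpa using hvw'.symm) h
  by_cases hwl : w' ∈ l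
  · by_cases hwm : w' ∈ m
    · exact .inl ⟨hwl, hwm⟩
    · have h₃ := sublist_left_of_notMem (s := [w', v']) (by simp [hwm, hvw'.symm]) h
      exact .inr (.inl ((h₃.append ((List.singleton_sublist.2 hm).cons_cons v)).cons_cons v))
  · have h₃ := sublist_right_of_notMem hwl h
    have h₃ := sublist_right_of_notMem (l := [v]) (by simpa using hvw'.symm) h₃
    exact .inr (.inr (((List.singleton_sublist.2 hl).append (h₃.cons_cons v)).cons_cons v))

/-! ### Interlacement across a cut -/

namespace FLDigraph

variable {U : FLDigraph}

/-- The cut of a set of vertices: the edges with exactly one end in the set. -/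
def cut (U : FLDigraph) (S : Set U.V) : Set U.E := {e | ¬ (U.tail e ∈ S ↔ U.head e ∈ S)}

theorem length_le_encard_cut_inter {S : Set U.V} {l : List U.E} (hn : l.Nodup)
    (hl : l.IsChain fun e f => U.head e = U.tail f) {s : List U.V} (hs : s.Sublist (l.map U.tail))
    (ha : s.IsChain fun x y => ¬ (x ∈ S ↔ y ∈ S)) :
    (s.length : ℕ∞) ≤ (U.cut S ∩ {e | e ∈ l}).encard + 1 := by
  induction l generalizing s with
  | nil => simp [List.sublist_nil.1 hs]
  | cons e l ih =>
    obtain ⟨he, hn⟩ := List.nodup_cons.1 hn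
    replace ih := fun s hs => ih hn hl.tail (s := s) hs
    have hmono : (U.cut S ∩ {f | f ∈ l}).encard ≤ (U.cut S ∩ {f | f ∈ e :: l}).encard :=
      Set.encard_le_encard (Set.inter_subset_inter_right _ fun f => List.mem_cons_of_mem e)
    obtain hs | ⟨s, rfl, hs'⟩ := List.sublist_cons_iff.1 hs
    · exact (ih s hs ha).trans (by gcongr)
    by_cases hec : e ∈ U.cut S
    · have hcut : U.cut S ∩ {f | f ∈ e :: l} = insert e (U.cut S ∩ {f | f ∈ l}) := by
        ext f
        simp only [Set.mem_inter_iff, Set.mem_ofPred_eq, List.mem_cons, Set.mem_insert_iff]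
        grind
      rw [hcut, Set.encard_insert_of_notMem fun h => he h.2, List.length_cons, Nat.cast_succ]
      gcongr
      exact ih s hs' ha.tail
    have hside : U.tail e ∈ S ↔ U.head e ∈ S := not_not.1 hec
    obtain _ | ⟨f, l⟩ := l
    · simp [List.sublist_nil.1 hs']
    -- The first letter `U.tail e` of `s` may be replaced by `U.tail f`, on the same side of `S`.
    rw [(List.isChain_cons_cons.1 hl).1] at hside
    obtain hs' | ⟨s, rfl, -⟩ := List.sublist_cons_iff.1 hs'
    · refine (ih (U.tail f :: s) (hs'.cons_cons _) ?_).trans (by gcongr)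
      grind [List.isChain_cons]
    · exact absurd hside (List.isChain_cons_cons.1 ha).1

namespace EulerSystem

variable {C : U.EulerSystem}

theorem Interlaced.exists_split {x y : U.V} (h : C.Interlaced x y) :
    ∃ c e A f B, ((e :: (A ++ f :: B) : List U.E) : Cycle U.E) = C.circuit c ∧
      U.tail e = x ∧ U.tail f = x ∧ y ∈ A.map U.tail ∧ y ∈ B.map U.tail := by
  obtain ⟨-, c, l, hl, hs⟩ := h
  obtain ⟨s, hsl, hsxy⟩ := List.sublist_map_iff.1 hs
  obtain ⟨e, f, e', f', rfl⟩ : ∃ e f e' f', s = [e, f, e', f'] :=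
    List.length_eq_four.1 (by simpa using (congrArg List.length hsxy).symm)
  obtain ⟨rfl, rfl, he, hf⟩ : x = U.tail e ∧ y = U.tail f ∧ x = U.tail e' ∧ y = U.tail f' := by
    simpa using hsxy
  obtain ⟨A, B, hr, hA, hB⟩ := exists_isRotated_of_sublist hsl
  exact ⟨c, e, A, e', B, (Cycle.coe_eq_coe.2 hr).symm.trans hl, rfl, he.symm,
    List.mem_map_of_mem hA, hf ▸ List.mem_map_of_mem hB⟩

theorem Interlaced.exists_forall_sublist {x y : U.V} (h : C.Interlaced x y) :
    ∃ c, ∀ l : List U.E, (l : Cycle U.E) = C.circuit c → [x, y, x].Sublist (l.map U.tail) := by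
  obtain ⟨-, c, l, hl, hs⟩ := h
  refine ⟨c, fun l' hl' => ?_⟩
  have hr : l.IsRotated l' := Cycle.coe_eq_coe.1 (hl.trans hl'.symm)
  obtain ⟨s, hr, hs⟩ := exists_isRotated_sublist hs (hr.map U.tail)
  obtain rfl | rfl := eq_or_eq_of_isRotated_alternating hr
  · exact .trans (by simp) hs
  · exact .trans (List.sublist_cons_self y _) hs

theorem isChain_of_circuit_eq (C : U.EulerSystem) {c : U.Component} {l : List U.E}
    (hl : (l : Cycle U.E) = C.circuit c) : l.IsChain fun e f => U.head e = U.tail f := by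
  have h := C.chain c
  rw [← hl] at h
  obtain _ | ⟨e, l⟩ := l
  · exact .nil
  · exact ((Cycle.chain_coe_cons ..).1 h).left_of_append (l₁ := e :: l)

theorem nodup_of_circuit_eq (C : U.EulerSystem) {c : U.Component} {l : List U.E}
    (hl : (l : Cycle U.E) = C.circuit c) : l.Nodup := by
  have h := C.nodup c
  rwa [← hl] at h

theorem length_le_encard_cut_inter_circuit (C : U.EulerSystem) {c : U.Component} {l : List U.E}
    (hl : (l : Cycle U.E) = C.circuit c) {S : Set U.V} {x : U.V} {s : List U.V}
    (hs : (x :: s).Sublist (l.map U.tail))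
    (ha : (x :: s).IsChain fun x y => ¬ (x ∈ S ↔ y ∈ S)) :
    (s.length : ℕ∞) ≤ (U.cut S ∩ {e | e ∈ C.circuit c}).encard := by
  have h := length_le_encard_cut_inter (C.nodup_of_circuit_eq hl) (C.isChain_of_circuit_eq hl) hs ha
  rw [List.length_cons, Nat.cast_succ, ENat.add_le_add_iff_right ENat.one_ne_top] at h
  rwa [← hl]

theorem encard_inter_circuit_add_le (C : U.EulerSystem) {c c' : U.Component} (h : c ≠ c')
    (s : Set U.E) :
    (s ∩ {e | e ∈ C.circuit c}).encard + (s ∩ {e | e ∈ C.circuit c'}).encard ≤ s.encard := by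
  have hdisj : Disjoint (s ∩ {e | e ∈ C.circuit c}) (s ∩ {e | e ∈ C.circuit c'}) :=
    Set.disjoint_left.2 fun e he he' =>
      h (((C.mem_iff c e).1 he.2).symm.trans ((C.mem_iff c' e).1 he'.2))
  rw [← Set.encard_union_eq hdisj]
  exact Set.encard_le_encard (Set.union_subset Set.inter_subset_left Set.inter_subset_left)

theorem Interlaced.of_encard_cut_le {S : Set U.V} (h4 : (U.cut S).encard ≤ 4) {v v' w w' : U.V}
    (hv : v ∈ S) (hv' : v' ∈ S) (hw : w ∉ S) (hw' : w' ∉ S) (h : C.Interlaced v w)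
    (h' : C.Interlaced v' w') : C.Interlaced v w' := by
  obtain ⟨c, e, A, f, B, hl, rfl, hf, hA, hB⟩ := h.exists_split
  obtain ⟨c', hc'⟩ := h'.symm.exists_forall_sublist
  have hvw' : U.tail e ≠ w' := fun heq => hw' (heq ▸ hv)
  have hmap : (e :: (A ++ f :: B)).map U.tail =
      U.tail e :: (A.map U.tail ++ U.tail e :: B.map U.tail) := by simp [hf]
  have hcount := fun x s => C.length_le_encard_cut_inter_circuit hl (S := S) (x := x) (s := s)
  rw [hmap] at hcount
  obtain rfl | hcc := eq_or_ne c c'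
  · have hfive : ¬ (5 : ℕ∞) ≤ (U.cut S ∩ {e | e ∈ C.circuit c}).encard := fun h5 =>
      absurd ((h5.trans (Set.encard_le_encard Set.inter_subset_left)).trans h4) (by norm_num)
    obtain ⟨hwA, hwB⟩ | hs | hs := mem_and_mem_or_sublist hvw' hA hB (hmap ▸ hc' _ hl)
    · exact ⟨hvw', c, _, hl, hmap ▸ sublist_alternating_of_mem hwA hwB⟩
    · exact absurd (hcount _ _ hs (by simp [hv, hv', hw, hw'])) hfive
    · exact absurd (hcount _ _ hs (by simp [hv, hv', hw, hw'])) hfive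
  · obtain ⟨l', hl'⟩ := Quot.exists_rep (C.circuit c')
    have h3 := hcount _ _ (sublist_alternating_of_mem hA hB) (by simp [hv, hw])
    have h2 := C.length_le_encard_cut_inter_circuit hl' (hc' l' hl') (S := S) (by simp [hv', hw'])
    have h5 := (add_le_add h3 h2).trans (C.encard_inter_circuit_add_le hcc (U.cut S))
    exact absurd (h5.trans h4) (by norm_num)

end EulerSystem
end FLDigraph

/-! ### Cycles of a permutation -/

section Perm

open Equiv Equiv.Perm

variable {E : Type*} {φ : Perm E}

theorem rel_of_sameCycle {r : E → E → Prop} (hr : Equivalence r) (h : ∀ x, r x (φ x)) {x y : E}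
    (hxy : φ.SameCycle x y) : r x y := by
  obtain ⟨n, rfl⟩ := hxy
  induction n with
  | zero => exact hr.refl x
  | succ n ih => exact hr.trans ih (by rw [add_comm, zpow_one_add, mul_apply]; exact h _)
  | pred n ih =>
    refine hr.trans ih (hr.symm ?_)
    have := h ((φ ^ (-(n : ℤ) - 1)) x)
    rwa [← mul_apply, ← zpow_one_add, add_sub_cancel] at this

theorem mem_of_sameCycle [Finite E] {S : Set E} (h : Set.MapsTo φ S S) {x y : E}
    (hxy : φ.SameCycle x y) (hx : x ∈ S) : y ∈ S := by
  obtain ⟨n, rfl⟩ := hxy.exists_nat_pow_eq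
  rw [← iterate_eq_pow]
  exact h.iterate n hx

theorem sameCycle_apply_self (φ : Perm E) (x : E) : φ.SameCycle (φ x) x :=
  sameCycle_apply_left.2 (.refl φ x)

theorem sameCycle_of_isChain {e f : E} {l : List E}
    (h : (e :: l).IsChain fun x y => y = φ x) (hf : f ∈ l) : φ.SameCycle e f := by
  induction l generalizing e with
  | nil => simp at hf
  | cons a l ih =>
    obtain ⟨rfl, h⟩ := List.isChain_cons_cons.1 h
    obtain rfl | hf := List.mem_cons.1 hf
    · exact (sameCycle_apply_self φ e).symm
    · exact (sameCycle_apply_self φ e).symm.trans (ih h hf)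

theorem apply_mem_of_isChain {e f a : E} {l : List E}
    (h : (e :: (l ++ [a])).IsChain fun x y => y = φ x) (hf : f ∈ e :: l) : φ f ∈ l ++ [a] := by
  induction l generalizing e with
  | nil => simp_all
  | cons b l ih =>
    obtain ⟨rfl, h⟩ := List.isChain_cons_cons.1 h
    obtain rfl | hf := List.mem_cons.1 hf
    · simp
    · exact List.mem_cons_of_mem _ (ih h hf)

variable [DecidableEq E]

theorem sameCycle_swap_apply {a b : E} (h : φ.SameCycle a b) (x : E) :
    φ.SameCycle (swap a b x) x := by
  rw [swap_apply_def]
  split_ifs with ha hb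
  · exact ha ▸ h.symm
  · exact hb ▸ h
  · exact .refl φ x

theorem isChain_swap_mul {a b e : E} {l : List E} (ha : a ∉ l) (hb : b ∉ l)
    (h : (e :: (l ++ [b])).IsChain fun x y => y = φ x) :
    (e :: (l ++ [a])).IsChain fun x y => y = (swap a b * φ) x := by
  induction l generalizing e with
  | nil => simp_all
  | cons c l ih =>
    obtain ⟨rfl, h⟩ := List.isChain_cons_cons.1 h
    simp only [List.mem_cons, not_or] at ha hb
    refine List.isChain_cons_cons.2 ⟨?_, ih ha.2 hb.2 h⟩
    rw [mul_apply, swap_apply_of_ne_of_ne (Ne.symm ha.1) (Ne.symm hb.1)]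

theorem sameCycle_swap_mul_self [Finite E] {a b : E} (h : ¬ φ.SameCycle a b) :
    (swap a b * φ).SameCycle a b := by
  by_contra hab
  have hmaps : Set.MapsTo φ {x | φ.SameCycle a x ∧ (swap a b * φ).SameCycle a x}
      {x | φ.SameCycle a x ∧ (swap a b * φ).SameCycle a x} := by
    rintro x ⟨hφ, hψ⟩
    refine ⟨sameCycle_apply_right.2 hφ, ?_⟩
    have hx : (swap a b * φ).SameCycle a (swap a b (φ x)) := sameCycle_apply_right.2 hψ
    rw [swap_apply_def] at hx
    split_ifs at hx with hxa hxb
    · exact absurd hx hab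
    · exact absurd (hxb ▸ sameCycle_apply_right.2 hφ) h
    · exact hx
  have hpred : (swap a b * φ).SameCycle a (φ.symm a) := (mem_of_sameCycle hmaps
    (sameCycle_symm_apply_right.2 (.refl φ a)) ⟨.refl _ _, .refl _ _⟩).2
  refine hab ?_
  simpa using sameCycle_apply_right.2 hpred

theorem sameCycle_swap_mul [Finite E] {a b x y : E} (h : ¬ φ.SameCycle a b)
    (hxy : φ.SameCycle x y) : (swap a b * φ).SameCycle x y :=
  rel_of_sameCycle (SameCycle.equivalence _) (fun z => (sameCycle_apply_self _ z).symm.trans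
    (sameCycle_swap_apply (sameCycle_swap_mul_self h) (φ z))) hxy

/-- Exchanging the images at `e, e'` splits the cycle in two, exchanging them at `f, f'` joins the
two parts again. -/
theorem sameCycle_swap_mul_swap_mul [Finite E] {e e' f f' x y : E} {A B : List E}
    (hc : ((e :: (A ++ e' :: B) : List E) : Cycle E).Chain fun x y => y = φ x)
    (hn : (e :: (A ++ e' :: B)).Nodup) (hf : f ∈ A) (hf' : f' ∈ B) (hxy : φ.SameCycle x y) :
    (swap f f' * (swap e e' * φ)).SameCycle x y := by
  set ψ := swap e e' * φ with hψ
  rw [Cycle.chain_coe_cons, List.append_assoc, List.cons_append, List.isChain_cons_split] at hc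
  have hA : (e :: (A ++ [e])).IsChain fun x y => y = ψ x :=
    isChain_swap_mul (by grind) (by grind) hc.1
  have hB : (e' :: (B ++ [e'])).IsChain fun x y => y = ψ x :=
    hψ ▸ swap_comm e e' ▸ isChain_swap_mul (by grind) (by grind) hc.2
  have hef : ψ.SameCycle e f := sameCycle_of_isChain hA (List.mem_append_left _ hf)
  have hef' : ψ.SameCycle e' f' := sameCycle_of_isChain hB (List.mem_append_left _ hf')
  have hff' : ¬ ψ.SameCycle f f' := fun h => by
    have hmaps : Set.MapsTo ψ {z | z ∈ A ++ [e]} {z | z ∈ A ++ [e]} := fun z hz =>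
      apply_mem_of_isChain hA (by simpa [or_comm] using hz)
    have : f' ∈ A ++ [e] := mem_of_sameCycle hmaps h (List.mem_append_left _ hf)
    grind
  set θ := swap f f' * ψ
  have hf : θ.SameCycle f f' := sameCycle_swap_mul_self hff'
  have he : θ.SameCycle e e' := ((sameCycle_swap_mul hff' hef).trans hf).trans
    (sameCycle_swap_mul hff' hef').symm
  refine rel_of_sameCycle (SameCycle.equivalence θ) (fun z => ?_) hxy
  exact ((sameCycle_apply_self θ z).symm.trans (sameCycle_swap_apply hf _)).trans
    (sameCycle_swap_apply he _)

theorem setOf_swap_mul_apply_ne_ssubset {φ₀ : Perm E} {p : E} (hp : φ p ≠ φ₀ p) :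
    {x | (swap (φ p) (φ₀ p) * φ) x ≠ φ₀ x} ⊂ {x | φ x ≠ φ₀ x} := by
  refine Set.ssubset_iff_exists.2 ⟨fun x hx hxφ => hx ?_, p, hp, by simp⟩
  have hpx : p ≠ x := fun h => hp (h ▸ hxφ)
  rw [mul_apply, swap_apply_of_ne_of_ne (φ.injective.ne hpx.symm)
    (hxφ ▸ φ₀.injective.ne hpx.symm), hxφ]

end Perm

/-! ### Eulerian permutations -/

namespace FLDigraph

open Equiv Equiv.Perm Function

variable {U : FLDigraph}

/-- A permutation of the edges whose cycles are Euler circuits: it continues every edge by an edge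
that begins where the first one ends, and all edges that begin at a vertex lie in one cycle. -/
structure IsEulerian (φ : Perm U.E) : Prop where
  head_eq : ∀ e, U.head e = U.tail (φ e)
  sameCycle : ∀ e e', U.tail e = U.tail e' → φ.SameCycle e e'

theorem tail_swap_apply [DecidableEq U.E] {e e' : U.E} (h : U.tail e = U.tail e') (x : U.E) :
    U.tail (swap e e' x) = U.tail x := by
  rw [swap_apply_def]
  split_ifs with he he'
  · rw [he, h]
  · rw [he', h]
  · rfl

theorem exists_isEulerian [Finite U.E] {φ₀ : Perm U.E} (h₀ : ∀ e, U.head e = U.tail (φ₀ e)) :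
    ∃ φ : Perm U.E, IsEulerian φ := by
  classical
  obtain ⟨φ, hφ, hmax⟩ := Set.exists_max_image {φ : Perm U.E | ∀ e, U.head e = U.tail (φ e)}
    (fun φ => {x : U.E × U.E | φ.SameCycle x.1 x.2}.ncard) (Set.toFinite _) ⟨φ₀, h₀⟩
  refine ⟨φ, hφ, fun e e' he => ?_⟩
  by_contra hc
  refine (hmax (swap e e' * φ) fun x => by rw [mul_apply, tail_swap_apply he, hφ x]).not_gt
    (Set.ncard_lt_ncard (Set.ssubset_iff_exists.2 ?_) (Set.toFinite _))
  exact ⟨fun x hx => sameCycle_swap_mul hc hx, (e, e'), sameCycle_swap_mul_self hc, hc⟩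

theorem IsEulerian.sameCycle_iff {φ : Perm U.E} (h : IsEulerian φ) (hs : Surjective U.tail)
    {e f : U.E} : φ.SameCycle e f ↔ U.component (U.tail e) = U.component (U.tail f) := by
  refine ⟨rel_of_sameCycle (r := fun e f => U.component (U.tail e) = U.component (U.tail f))
    ⟨fun _ => rfl, Eq.symm, Eq.trans⟩ fun x => ?_, fun hef => ?_⟩
  · rw [← h.head_eq]
    exact Quot.sound ⟨x, rfl, rfl⟩
  let F : U.Component → Quotient (SameCycle.setoid φ) :=
    Quot.lift (fun x => Quotient.mk _ (surjInv hs x)) (by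
      rintro _ _ ⟨e, rfl, rfl⟩
      refine Quotient.sound (s := SameCycle.setoid φ) ?_
      exact ((h.sameCycle _ _ (surjInv_eq hs _)).trans (sameCycle_apply_self φ e).symm).trans
        (h.sameCycle _ _ ((h.head_eq e).symm.trans (surjInv_eq hs _).symm)))
  have hF : ∀ e, F (U.component (U.tail e)) = Quotient.mk _ e := fun e =>
    Quotient.sound (s := SameCycle.setoid φ) (h.sameCycle _ _ (surjInv_eq hs _))
  exact Quotient.exact ((hF e).symm.trans ((congrArg F hef).trans (hF f)))

theorem IsEulerian.exists_eulerSystem [Finite U.E] {φ : Perm U.E} (h : IsEulerian φ)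
    (hs : Surjective U.tail) :
    ∃ C : U.EulerSystem, ∀ c, (C.circuit c).Chain fun e f => f = φ e := by
  have hsc : ∀ c : U.Component, ∃ e, U.component (U.tail e) = c :=
    Quot.mk_surjective.comp hs
  choose b hb using hsc
  have hchain : ∀ c, (periodicOrbit φ (b c)).Chain fun e f => f = φ e := fun c => by
    rw [periodicOrbit_chain]
    exact fun n _ => iterate_succ_apply' φ n (b c)
  refine ⟨⟨fun c => periodicOrbit φ (b c), fun c => (hchain c).imp fun e f hef => ?_,
    fun c => nodup_periodicOrbit, fun c e => ?_⟩, hchain⟩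
  · rw [hef, h.head_eq]
  · have hper : b c ∈ periodicPts φ := φ.injective.mem_periodicPts _
    rw [mem_periodicOrbit_iff hper, ← hb c, eq_comm, ← h.sameCycle_iff hs, hb]
    constructor
    · rintro ⟨n, rfl⟩
      exact ⟨n, by rw [zpow_natCast, iterate_eq_pow]⟩
    · intro hce
      obtain ⟨n, hn⟩ := hce.exists_nat_pow_eq
      exact ⟨n, by rw [iterate_eq_pow, hn]⟩

theorem EulerSystem.Follows.rel {C : U.EulerSystem} {r : U.E → U.E → Prop}
    (hr : ∀ c, (C.circuit c).Chain r) {e f : U.E} (h : C.Follows e f) : r e f := by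
  obtain ⟨c, l, hl, hf⟩ := h
  have hc := hr c
  rw [← hl, Cycle.chain_coe_cons] at hc
  obtain ⟨t, ht⟩ := List.head?_eq_some_iff.1 hf
  rw [ht] at hc
  exact (List.isChain_cons_cons.1 hc).1

theorem IsEulerian.swap_mul_swap_mul [DecidableEq U.E] [Finite U.E] {φ : Perm U.E}
    (h : IsEulerian φ) {e e' f f' : U.E} {A B : List U.E}
    (hc : ((e :: (A ++ e' :: B) : List U.E) : Cycle U.E).Chain fun x y => y = φ x)
    (hn : (e :: (A ++ e' :: B)).Nodup) (hf : f ∈ A) (hf' : f' ∈ B)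
    (he : U.tail e = U.tail e') (hff' : U.tail f = U.tail f') :
    IsEulerian (swap f f' * (swap e e' * φ)) where
  head_eq x := by
    rw [mul_apply, mul_apply, tail_swap_apply hff', tail_swap_apply he, h.head_eq]
  sameCycle x y hxy := sameCycle_swap_mul_swap_mul hc hn hf hf' (h.sameCycle x y hxy)

theorem swap_eq_swap_of_head_eq_tail [DecidableEq U.E]
    (h2 : ∀ x y z : U.E, U.tail x = U.tail y → U.tail y = U.tail z → x = y ∨ y = z ∨ x = z)
    {p a b e e' : U.E} (ha : U.head p = U.tail a) (hb : U.head p = U.tail b) (hab : a ≠ b)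
    (he : U.tail e = U.head p) (he' : U.tail e' = U.head p) (hee' : e ≠ e') :
    swap e e' = swap a b := by
  have h := h2 e e' a
  have h' := h2 e e' b
  obtain ⟨rfl, rfl⟩ | ⟨rfl, rfl⟩ : (a = e ∧ b = e') ∨ (a = e' ∧ b = e) := by grind
  · rfl
  · exact swap_comm b a

/-- The Euler system departs from `φ₀` as rarely as possible: if two departures were at interlaced
vertices, then undoing both of them would give another Euler system. -/
theorem exists_eulerSystem_not_interlaced [Finite U.E] {φ₀ : Perm U.E}
    (h₀ : ∀ e, U.head e = U.tail (φ₀ e)) (hs : Surjective U.tail)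
    (h2 : ∀ x y z : U.E, U.tail x = U.tail y → U.tail y = U.tail z → x = y ∨ y = z ∨ x = z) :
    ∃ C : U.EulerSystem, ∀ p p' q q', C.Follows p p' → C.Follows q q' → p' ≠ φ₀ p → q' ≠ φ₀ q →
      ¬ C.Interlaced (U.head p) (U.head q) := by
  classical
  obtain ⟨φ, hφ, hmin⟩ := Set.exists_min_image {φ : Perm U.E | IsEulerian φ}
    (fun φ => {x | φ x ≠ φ₀ x}.ncard) (Set.toFinite _) (exists_isEulerian h₀)
  obtain ⟨C, hC⟩ := hφ.exists_eulerSystem hs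
  refine ⟨C, fun p p' q q' hpp' hqq' hp hq hpq => ?_⟩
  obtain rfl := hpp'.rel hC
  obtain rfl := hqq'.rel hC
  obtain ⟨c, e, A, e', B, hl, he, he', hA, hB⟩ := hpq.exists_split
  obtain ⟨f, hfA, hf⟩ := List.mem_map.1 hA
  obtain ⟨f', hfB, hf'⟩ := List.mem_map.1 hB
  have hn : (e :: (A ++ e' :: B)).Nodup := C.nodup_of_circuit_eq hl
  have hθ : IsEulerian (swap f f' * (swap e e' * φ)) :=
    hφ.swap_mul_swap_mul (hl ▸ hC c) hn hfA hfB (he.trans he'.symm) (hf.trans hf'.symm)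
  have hψq : (swap e e' * φ) q = φ q := by
    have hφq := hφ.head_eq q
    have hne := hpq.1
    exact swap_apply_of_ne_of_ne (by grind) (by grind)
  have hswap : swap e e' = swap (φ p) (φ₀ p) :=
    swap_eq_swap_of_head_eq_tail h2 (hφ.head_eq p) (h₀ p) hp he he' (by grind)
  have hswap' : swap f f' = swap ((swap e e' * φ) q) (φ₀ q) := hψq ▸
    swap_eq_swap_of_head_eq_tail h2 (hφ.head_eq q) (h₀ q) hq hf hf' (by grind)
  have hlt := hswap' ▸ (setOf_swap_mul_apply_ne_ssubset (hψq ▸ hq)).trans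
    (hswap ▸ setOf_swap_mul_apply_ne_ssubset hp)
  exact (hmin _ hθ).not_gt (Set.ncard_lt_ncard hlt (Set.toFinite _))

end FLDigraph

/-! ### Compositions of marked graphs -/

namespace MarkedGraph

variable {X : Type u} {R : Type v} {G F H : MarkedGraph X R} {S : Set X} {a : X} {A B : R}

theorem right_mem (G : MarkedGraph X R) {x y : X} (h : G.Adj x y) : y ∈ G.verts :=
  G.left_mem (G.adj_symm h)

theorem adj_comm (G : MarkedGraph X R) {x y : X} : G.Adj x y ↔ G.Adj y x :=
  ⟨G.adj_symm, G.adj_symm⟩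

theorem ne_of_adj (G : MarkedGraph X R) {x y : X} (h : G.Adj x y) : x ≠ y :=
  fun hxy => G.adj_irrefl y (hxy ▸ h)

theorem IsInducedSubgraph.congr {S' : Set X} (h : F.IsInducedSubgraph G S)
    (hS : G.verts ∩ S = G.verts ∩ S') : F.IsInducedSubgraph G S' :=
  { h with verts_eq := h.verts_eq.trans hS }

theorem IsInducedSubgraph.adj_iff_adj_and_mem (h : F.IsInducedSubgraph G S) {x y : X} :
    F.Adj x y ↔ G.Adj x y ∧ x ∈ S ∧ y ∈ S := by
  have hmem : ∀ z, z ∈ F.verts ↔ z ∈ G.verts ∩ S := fun z => by rw [h.verts_eq]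
  constructor
  · intro hxy
    have hx := F.left_mem hxy
    have hy := F.right_mem hxy
    exact ⟨(h.adj_iff x hx y hy).1 hxy, ((hmem x).1 hx).2, ((hmem y).1 hy).2⟩
  · rintro ⟨hxy, hx, hy⟩
    exact (h.adj_iff x ((hmem x).2 ⟨G.left_mem hxy, hx⟩) y
      ((hmem y).2 ⟨G.right_mem hxy, hy⟩)).2 hxy

theorem isComposition_of_isInducedSubgraph (hFa : F.IsStandardVertex A B a)
    (hHa : H.IsStandardVertex A B a) (hF : (F.deleteVert a).IsInducedSubgraph G Sᶜ)
    (hH : (H.deleteVert a).IsInducedSubgraph G S)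
    (hadj : ∀ x ∉ S, ∀ y ∈ S, (G.Adj x y ↔ F.Adj x a ∧ H.Adj a y))
    (hloops : G.freeLoops = F.freeLoops + H.freeLoops) : G.IsComposition F H A B a where
  inter_eq := by
    have hFv : F.verts \ {a} = G.verts ∩ Sᶜ := hF.verts_eq
    have hHv : H.verts \ {a} = G.verts ∩ S := hH.verts_eq
    rw [← Set.insert_sdiff_self_of_mem hFa.mem, ← Set.insert_sdiff_self_of_mem hHa.mem, hFv, hHv,
      ← Set.insert_inter_distrib, Set.inter_inter_inter_comm, Set.compl_inter_self,
      Set.inter_empty, insert_empty_eq]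
  left_standard := hFa
  right_standard := hHa
  verts_eq := by
    have hFv : F.verts \ {a} = G.verts ∩ Sᶜ := hF.verts_eq
    have hHv : H.verts \ {a} = G.verts ∩ S := hH.verts_eq
    rw [Set.union_sdiff_distrib, hFv, hHv, ← Set.inter_union_distrib_left, Set.compl_union_self,
      Set.inter_univ]
  left_looped x hx := (hF.looped_iff x hx).symm.trans (and_iff_left hx.2)
  right_looped x hx := (hH.looped_iff x hx).symm.trans (and_iff_left hx.2)
  left_marked x hx := (hF.marked_iff x hx).symm.trans (and_iff_left hx.2)
  right_marked x hx := (hH.marked_iff x hx).symm.trans (and_iff_left hx.2)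
  left_wα x hx := (hF.wα_eq x hx).symm
  right_wα x hx := (hH.wα_eq x hx).symm
  left_wβ x hx := (hF.wβ_eq x hx).symm
  right_wβ x hx := (hH.wβ_eq x hx).symm
  adj_iff x y := by
    have hFS : ∀ z, F.Adj z a → z ∉ S := fun z hz =>
      (hF.verts_eq.subset ⟨F.left_mem hz, F.ne_of_adj hz⟩).2
    have hHS : ∀ z, H.Adj a z → z ∈ S := fun z hz =>
      (hH.verts_eq.subset ⟨H.right_mem hz, (H.ne_of_adj hz).symm⟩).2
    rw [hF.adj_iff_adj_and_mem, hH.adj_iff_adj_and_mem]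
    grind [hadj x, hadj y, G.adj_comm (x := x) (y := y)]
  freeLoops_eq := hloops

open Classical in
/-- The graph obtained from the subgraph of `G` induced by `S`, with `k` free loops, by adjoining
an unlooped, unmarked vertex `a` with weights `A` and `B`, which stands for the vertices not in
`S`: it is adjacent to the vertices in `S` that have a neighbor not in `S`. -/
noncomputable def collapseCompl (G : MarkedGraph X R) (S : Set X) {a : X} (ha : a ∉ G.verts)
    (k : ℕ) (A B : R) : MarkedGraph X R where
  verts := insert a (G.verts ∩ S)
  finite_verts := (G.finite_verts.inter_of_left S).insert a
  Adj x y := (G.Adj x y ∧ x ∈ S ∧ y ∈ S) ∨ (x = a ∧ y ∈ S ∧ ∃ z ∉ S, G.Adj y z) ∨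
    (y = a ∧ x ∈ S ∧ ∃ z ∉ S, G.Adj x z)
  adj_symm := Or.imp (fun h => ⟨G.adj_symm h.1, h.2.2, h.2.1⟩) Or.symm
  adj_irrefl := by
    rintro x (h | ⟨rfl, -, z, -, h⟩ | ⟨rfl, -, z, -, h⟩)
    exacts [G.adj_irrefl x h.1, ha (G.left_mem h), ha (G.left_mem h)]
  left_mem := by
    rintro x y (⟨h, hx, -⟩ | ⟨rfl, -⟩ | ⟨-, hx, z, -, h⟩)
    exacts [.inr ⟨G.left_mem h, hx⟩, .inl rfl, .inr ⟨G.left_mem h, hx⟩]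
  looped := G.looped ∩ S
  looped_subset := fun _ h => .inr ⟨G.looped_subset h.1, h.2⟩
  marked := G.marked ∩ S
  marked_subset := fun _ h => .inr ⟨G.marked_subset h.1, h.2⟩
  freeLoops := k
  wα := Function.update G.wα a A
  wβ := Function.update G.wβ a B

theorem isStandardVertex_collapseCompl (S : Set X) (ha : a ∉ G.verts) (k : ℕ) (A B : R) :
    (G.collapseCompl S ha k A B).IsStandardVertex A B a where
  mem := .inl rfl
  not_looped h := ha (G.looped_subset h.1)
  not_marked h := ha (G.marked_subset h.1)
  wα_eq := by simp [collapseCompl]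
  wβ_eq := by simp [collapseCompl]

theorem isInducedSubgraph_deleteVert_collapseCompl (S : Set X) (ha : a ∉ G.verts) {k : ℕ}
    (hk : k ≤ G.freeLoops) (A B : R) :
    ((G.collapseCompl S ha k A B).deleteVert a).IsInducedSubgraph G S where
  verts_eq := Set.insert_sdiff_self_of_notMem fun h => ha h.1
  adj_iff := by
    rintro x ⟨hx | hx, hxa⟩ y ⟨hy | hy, hya⟩ <;> simp_all [collapseCompl, deleteVert]
  looped_iff := by
    rintro x ⟨hx | hx, hxa⟩ <;> simp_all [collapseCompl, deleteVert]
  marked_iff := by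
    rintro x ⟨hx | hx, hxa⟩ <;> simp_all [collapseCompl, deleteVert]
  wα_eq x hx := by simp [collapseCompl, deleteVert, show x ≠ a from hx.2]
  wβ_eq x hx := by simp [collapseCompl, deleteVert, show x ≠ a from hx.2]
  freeLoops_le := hk

theorem collapseCompl_adj_apex (S : Set X) (ha : a ∉ G.verts) (k : ℕ) (A B : R) {x : X} :
    (G.collapseCompl S ha k A B).Adj x a ↔ x ∈ S ∧ ∃ z ∉ S, G.Adj x z := by
  refine ⟨?_, fun h => .inr (.inr ⟨rfl, h⟩)⟩
  rintro (⟨h, -⟩ | ⟨-, -, z, -, h⟩ | h)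
  exacts [absurd (G.right_mem h) ha, absurd (G.left_mem h) ha, h.2]

theorem exists_isComposition
    (h : ∀ v ∈ S, ∀ v' ∈ S, ∀ w ∉ S, ∀ w' ∉ S, G.Adj v w → G.Adj v' w' → G.Adj v w')
    (ha : a ∉ G.verts) (A B : R) :
    ∃ F H, G.IsComposition F H A B a ∧ (F.deleteVert a).IsInducedSubgraph G Sᶜ ∧
      (H.deleteVert a).IsInducedSubgraph G S := by
  have hF := isInducedSubgraph_deleteVert_collapseCompl Sᶜ ha (Nat.zero_le _) A B
  have hH := isInducedSubgraph_deleteVert_collapseCompl S ha le_rfl A B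
  refine ⟨_, _, isComposition_of_isInducedSubgraph (isStandardVertex_collapseCompl ..)
    (isStandardVertex_collapseCompl ..) hF hH (fun x hx y hy => ?_) (Nat.zero_add _).symm, hF, hH⟩
  rw [collapseCompl_adj_apex, adj_comm _ (x := a), collapseCompl_adj_apex]
  constructor
  · exact fun hxy => ⟨⟨hx, y, not_not.2 hy, hxy⟩, hy, x, hx, G.adj_symm hxy⟩
  · rintro ⟨⟨-, y', hy', hxy'⟩, -, x', hx', hyx'⟩
    exact G.adj_symm (h y hy y' (not_not.1 hy') x' hx' x hx hyx' (G.adj_symm hxy'))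

theorem IsComposition.noMarkedNeighbor_or (h : G.IsComposition F H A B a)
    (hG : ∀ x ∈ G.marked, ∀ y ∈ G.marked, ¬ G.Adj x y) :
    F.NoMarkedNeighbor a ∨ H.NoMarkedNeighbor a := by
  by_contra! hFH
  simp only [NoMarkedNeighbor, not_forall, not_not] at hFH
  obtain ⟨⟨x, hx, hxa⟩, y, hy, hya⟩ := hFH
  exact hG x ((h.left_marked x ⟨F.left_mem hxa, F.ne_of_adj hxa⟩).2 hx)
    y ((h.right_marked y ⟨H.left_mem hya, H.ne_of_adj hya⟩).2 hy)
    ((h.adj_iff x y).2 (.inr (.inr (.inl ⟨hxa, H.adj_symm hya⟩))))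

end MarkedGraph

/-! ### Arcs of a link diagram -/

namespace LinkDiagram

open FLDigraph

variable {D : LinkDiagram}

/-- The passage reached from the passage `p` after time `r`, a full turn taking time `1`. -/
def advance (p : D.Passage) (r : ℝ) : D.Passage := (p.1, p.2 + (r : UnitAddCircle))

theorem advance_zero (p : D.Passage) : advance p 0 = p := by simp [advance]

theorem advance_one (p : D.Passage) : advance p 1 = p := by
  simp [advance, show ((1 : ℝ) : UnitAddCircle) = 0 from AddCircle.coe_period 1]

theorem advance_advance (p : D.Passage) (r s : ℝ) :
    advance (advance p r) s = advance p (r + s) := by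
  simp [advance, add_assoc]

theorem injOn_advance (p : D.Passage) : Set.InjOn (advance p) (Set.Ioc 0 1) := by
  intro r hr s hs h
  rw [← zero_add (1 : ℝ)] at hr hs
  exact (AddCircle.coe_eq_coe_iff_of_mem_Ioc hr hs).1 (add_left_cancel (Prod.ext_iff.1 h).2)

theorem continuous_pt_advance (p : D.Passage) : Continuous fun r => D.pt (advance p r) :=
  (D.continuous_curve p.1).comp (continuous_const.add (AddCircle.continuous_mk' 1))

theorem isArc_iff {p q : D.Passage} : D.IsArc p q ↔ D.pt p ∈ D.classical ∧ D.pt q ∈ D.classical ∧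
    ∃ s : ℝ, 0 < s ∧ s ≤ 1 ∧ q = advance p s ∧
      ∀ r : ℝ, 0 < r → r < s → D.pt (advance p r) ∉ D.classical := by
  simp only [IsArc, advance, Prod.ext_iff]
  constructor
  · rintro ⟨hp, hq, hqp, s, hs, hs1, hqs, hr⟩
    exact ⟨hp, hq, s, hs, hs1, ⟨hqp, hqs⟩, hr⟩
  · rintro ⟨hp, hq, s, hs, hs1, ⟨hqp, hqs⟩, hr⟩
    exact ⟨hp, hq, hqp, s, hs, hs1, hqs, hr⟩

theorem finite_classical_passages (D : LinkDiagram) : {p | D.pt p ∈ D.classical}.Finite := by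
  refine (D.finite_crossings.subset D.classical_subset).preimage' (f := D.pt) fun x hx => ?_
  obtain ⟨p, q, hpq, hp, hq⟩ := D.classical_subset hx
  refine (Set.toFinite {p, q}).subset fun r hr => ?_
  rcases D.double p q r (hp.trans hq.symm) (hq.trans (Eq.symm hr)) with h | h | h
  exacts [absurd h hpq, .inr h.symm, .inl h.symm]

theorem exists_isArc {p : D.Passage} (hp : D.pt p ∈ D.classical) : ∃ q, D.IsArc p q := by
  have hfin : (Set.Ioc 0 1 ∩ {r | D.pt (advance p r) ∈ D.classical}).Finite :=
    .of_finite_image (D.finite_classical_passages.subset (Set.image_subset_iff.2 fun _ hr => hr.2))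
      ((injOn_advance p).mono Set.inter_subset_left)
  obtain ⟨s, ⟨⟨hs0, hs1⟩, hs⟩, hmin⟩ := Set.exists_min_image _ id hfin
    ⟨1, ⟨one_pos, le_rfl⟩, by rwa [Set.mem_ofPred_eq, advance_one]⟩
  exact ⟨advance p s, isArc_iff.2 ⟨hp, hs, s, hs0, hs1, rfl, fun r hr hrs h =>
    hrs.not_ge (hmin r ⟨⟨hr, hrs.le.trans hs1⟩, h⟩)⟩⟩

theorem IsArc.right_unique {p q q' : D.Passage} (h : D.IsArc p q) (h' : D.IsArc p q') :
    q = q' := by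
  obtain ⟨-, hq, s, hs, -, rfl, hr⟩ := isArc_iff.1 h
  obtain ⟨-, hq', s', hs', -, rfl, hr'⟩ := isArc_iff.1 h'
  rcases lt_trichotomy s s' with hlt | rfl | hlt
  · exact absurd hq (hr' s hs hlt)
  · rfl
  · exact absurd hq' (hr s' hs' hlt)

theorem eq_of_advance_eq_advance {p p' : D.Passage} (hp : D.pt p ∈ D.classical)
    (hp' : D.pt p' ∈ D.classical) {r r' : ℝ} (hr : 0 < r) (hr' : 0 < r')
    (h : ∀ t, 0 < t → t < r → D.pt (advance p t) ∉ D.classical)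
    (h' : ∀ t, 0 < t → t < r' → D.pt (advance p' t) ∉ D.classical)
    (heq : advance p r = advance p' r') : p = p' := by
  wlog hle : r ≤ r' generalizing p p' r r'
  · exact (this hp' hp hr' hr h' h heq.symm (not_le.1 hle).le).symm
  have hpp : p = advance p' (r' - r) := by
    have := congrArg (advance · (-r)) heq
    simpa only [advance_advance, add_neg_cancel, advance_zero, ← sub_eq_add_neg] using this
  rcases hle.eq_or_lt with rfl | hlt
  · rwa [sub_self, advance_zero] at hpp
  · rw [hpp] at hp
    exact absurd hp (h' _ (sub_pos.2 hlt) (sub_lt_self r' hr))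

theorem IsArc.left_unique {p p' q : D.Passage} (h : D.IsArc p q) (h' : D.IsArc p' q) :
    p = p' := by
  obtain ⟨hp, -, s, hs, -, rfl, hr⟩ := isArc_iff.1 h
  obtain ⟨hp', -, s', hs', -, heq, hr'⟩ := isArc_iff.1 h'
  exact eq_of_advance_eq_advance hp hp' hs hs' hr hr' heq

theorem edge_ext {e f : D.directedUniverse.E} (h : e.1.1 = f.1.1) : e = f :=
  Subtype.ext (Prod.ext h (e.2.right_unique (h ▸ f.2)))

instance finite_directedUniverse_edges : Finite D.directedUniverse.E :=
  have := D.finite_classical_passages.to_subtype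
  .of_injective (fun e : D.directedUniverse.E => (⟨e.1.1, e.2.1⟩ : {p | D.pt p ∈ D.classical}))
    fun _ _ h => edge_ext (Subtype.ext_iff.1 h)

theorem tail_surjective : Function.Surjective D.directedUniverse.tail := by
  rintro ⟨x, hx⟩
  obtain ⟨p, -, -, rfl, -⟩ := D.classical_subset hx
  obtain ⟨q, hq⟩ := exists_isArc hx
  exact ⟨⟨(p, q), hq⟩, rfl⟩

theorem eq_or_eq_or_eq_of_tail_eq (e f g : D.directedUniverse.E)
    (hef : D.directedUniverse.tail e = D.directedUniverse.tail f)
    (hfg : D.directedUniverse.tail f = D.directedUniverse.tail g) : e = f ∨ f = g ∨ e = g :=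
  (D.double e.1.1 f.1.1 g.1.1 (Subtype.ext_iff.1 hef) (Subtype.ext_iff.1 hfg)).imp edge_ext
    (Or.imp edge_ext edge_ext)

theorem exists_perm_follows_components (D : LinkDiagram) :
    ∃ φ : Equiv.Perm D.directedUniverse.E, ∀ e, (φ e).1.1 = e.1.2 := by
  have h (e : D.directedUniverse.E) : ∃ f : D.directedUniverse.E, f.1.1 = e.1.2 := by
    obtain ⟨q, hq⟩ := exists_isArc e.2.2.1
    exact ⟨⟨(e.1.2, q), hq⟩, rfl⟩
  choose f hf using h
  have hinj : Function.Injective f := fun e e' hee => by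
    have hq : e.1.2 = e'.1.2 := by rw [← hf e, ← hf e', hee]
    exact edge_ext (e.2.left_unique (hq ▸ e'.2))
  exact ⟨Equiv.ofBijective f (Finite.injective_iff_bijective.1 hinj), hf⟩

theorem exists_eulerSystem_marked_not_interlaced (D : LinkDiagram) :
    ∃ C : D.EulerSystem, ∀ x y : D.directedUniverse.V, x.1 ∈ D.markedCrossings C →
      y.1 ∈ D.markedCrossings C → ¬ C.Interlaced x y := by
  obtain ⟨φ, hφ⟩ := D.exists_perm_follows_components
  obtain ⟨C, hC⟩ := exists_eulerSystem_not_interlaced (φ₀ := φ)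
    (fun e => Subtype.ext (congrArg D.pt (hφ e).symm)) tail_surjective eq_or_eq_or_eq_of_tail_eq
  refine ⟨C, ?_⟩
  rintro ⟨_, -⟩ ⟨_, -⟩ ⟨e, e', hee', rfl, he⟩ ⟨f, f', hff', rfl, hf⟩
  exact hC e e' f f' hee' hff' (fun h => he (by rw [h, hφ])) (fun h => hf (by rw [h, hφ]))

/-! ### Decompositions along a tangle -/

namespace Tangle

variable (T : D.Tangle)

theorem notMem_boundary_of_classical {x : Plane} (hx : x ∈ D.classical) : x ∉ T.boundary :=
  fun h => Set.disjoint_left.1 T.not_crossing h (D.classical_subset hx)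

theorem mem_outside_iff {x : Plane} (hx : x ∈ D.classical) : x ∈ T.outside ↔ x ∉ T.inside := by
  simp [inside, outside, T.notMem_boundary_of_classical hx]

theorem mem_inside_iff_of_isPreconnected {x y : Plane} {A : Set Plane} (hA : IsPreconnected A)
    (hAT : A ⊆ T.boundaryᶜ) (hx : x ∈ A) (hy : y ∈ A) : x ∈ T.inside ↔ y ∈ T.inside :=
  and_congr (iff_of_true (hAT hx) (hAT hy))
    (by rw [connectedComponentIn_eq (hA.subset_connectedComponentIn hx hAT hy)])

theorem exists_advance_mem_boundary {e : D.directedUniverse.E}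
    (he : e ∈ D.directedUniverse.cut (Subtype.val ⁻¹' T.inside)) :
    ∃ r : ℝ, 0 < r ∧ (∀ t, 0 < t → t < r → D.pt (advance e.1.1 t) ∉ D.classical) ∧
      D.pt (advance e.1.1 r) ∈ T.boundary := by
  obtain ⟨hp, -, s, hs, -, hq, hr⟩ := isArc_iff.1 e.2
  by_contra! hc
  refine he (T.mem_inside_iff_of_isPreconnected
    (A := (fun r => D.pt (advance e.1.1 r)) '' Set.Icc 0 s) ?_ ?_ ?_ ?_)
  · exact isPreconnected_Icc.image _ (continuous_pt_advance _).continuousOn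
  · rintro _ ⟨r, ⟨hr0, hrs⟩, rfl⟩
    rcases hr0.eq_or_lt with rfl | hr0
    · simpa only [advance_zero, Set.mem_compl_iff] using T.notMem_boundary_of_classical hp
    · exact hc r hr0 fun t ht0 htr => hr t ht0 (htr.trans_le hrs)
  · exact ⟨0, ⟨le_rfl, hs.le⟩, congrArg D.pt (advance_zero _)⟩
  · exact ⟨s, ⟨hs.le, le_rfl⟩, congrArg D.pt hq.symm⟩

theorem eq_of_pt_mem_boundary {p q : D.Passage} (h : D.pt p ∈ T.boundary)
    (hpq : D.pt p = D.pt q) : p = q := by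
  by_contra hne
  exact Set.disjoint_left.1 T.not_crossing h ⟨p, q, hne, rfl, hpq.symm⟩

theorem encard_cut_inside_le :
    (D.directedUniverse.cut (Subtype.val ⁻¹' T.inside)).encard ≤ 4 := by
  rw [← T.four_points]
  have h (e) (he : e ∈ D.directedUniverse.cut (Subtype.val ⁻¹' T.inside)) :=
    T.exists_advance_mem_boundary he
  choose! r hr0 hr hrT using h
  refine Set.encard_le_encard_of_injOn (f := fun e => D.pt (advance e.1.1 (r e)))
    (fun e he => ⟨hrT e he, Set.mem_range_self _⟩) fun e he f hf hef => ?_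
  exact edge_ext (eq_of_advance_eq_advance e.2.1 f.2.1 (hr0 e he) (hr0 f hf) (hr e he) (hr f hf)
    (T.eq_of_pt_mem_boundary (hrT e he) hef))

end Tangle

theorem interlacementGraph_adj_of_encard_cut_le {S : Set Plane}
    (h4 : (D.directedUniverse.cut (Subtype.val ⁻¹' S)).encard ≤ 4) (C : D.EulerSystem)
    {R : Type v} (α β : Plane → R) {v v' w w' : Plane} (hv : v ∈ S) (hv' : v' ∈ S) (hw : w ∉ S)
    (hw' : w' ∉ S) (h : (D.interlacementGraph C α β).Adj v w)
    (h' : (D.interlacementGraph C α β).Adj v' w') : (D.interlacementGraph C α β).Adj v w' := by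
  obtain ⟨hvc, hwc, h⟩ := h
  obtain ⟨hvc', hwc', h'⟩ := h'
  exact ⟨hvc, hwc', .of_encard_cut_le h4 (v := ⟨v, hvc⟩) (v' := ⟨v', hvc'⟩) (w := ⟨w, hwc⟩)
    (w' := ⟨w', hwc'⟩) hv hv' hw hw' h h'⟩

theorem isTangleDecomposition_iff {T : D.Tangle} {C : D.EulerSystem} {R : Type v} {A B : R}
    {α β : Plane → R} {F H : MarkedGraph Plane R} {a : Plane} :
    D.IsTangleDecomposition T C A B α β F H a ↔
      (D.interlacementGraph C α β).IsComposition F H A B a ∧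
      (F.deleteVert a).IsInducedSubgraph (D.interlacementGraph C α β) T.insideᶜ ∧
      (H.deleteVert a).IsInducedSubgraph (D.interlacementGraph C α β) T.inside := by
  have hT : D.classical ∩ T.outside = D.classical ∩ T.insideᶜ :=
    Set.ext fun x => and_congr_right T.mem_outside_iff
  exact ⟨fun ⟨h, hF, hH⟩ => ⟨h, hF.congr hT, hH⟩, fun ⟨h, hF, hH⟩ => ⟨h, hF.congr hT.symm, hH⟩⟩

end LinkDiagram

theorem theorem3_general (D : LinkDiagram) :
    (∀ S : Set Plane, (D.directedUniverse.cut (Subtype.val ⁻¹' S)).encard ≤ 4 →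
      ∀ (C : D.EulerSystem) (R : Type u) (A B : R) (α β : Plane → R),
        ∃ (F H : MarkedGraph Plane R) (a : Plane),
          (D.interlacementGraph C α β).IsComposition F H A B a ∧
          (F.deleteVert a).IsInducedSubgraph (D.interlacementGraph C α β) Sᶜ ∧
          (H.deleteVert a).IsInducedSubgraph (D.interlacementGraph C α β) S) ∧
    (∃ C : D.EulerSystem, ∀ (R : Type u) (A B : R) (α β : Plane → R)
      (F H : MarkedGraph Plane R) (a : Plane),
        (D.interlacementGraph C α β).IsComposition F H A B a →
          F.NoMarkedNeighbor a ∨ H.NoMarkedNeighbor a) := by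
  constructor
  · intro S hS C R A B α β
    obtain ⟨a, ha⟩ := (D.interlacementGraph C α β).finite_verts.exists_notMem
    obtain ⟨F, H, hFH⟩ := MarkedGraph.exists_isComposition (S := S)
      (fun v hv v' hv' w hw w' hw' =>
        LinkDiagram.interlacementGraph_adj_of_encard_cut_le hS C α β hv hv' hw hw') ha A B
    exact ⟨F, H, a, hFH⟩
  · obtain ⟨C, hC⟩ := D.exists_eulerSystem_marked_not_interlaced
    exact ⟨C, fun R A B α β F H a h =>
      h.noMarkedNeighbor_or fun x hx y hy ⟨hxc, hyc, hxy⟩ => hC ⟨x, hxc⟩ ⟨y, hyc⟩ hx hy hxy⟩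

theorem theorem3 (D : LinkDiagram) (T : D.Tangle) :
    (∀ (C : D.EulerSystem) (R : Type u) [CommRing R] (A B : R) (α β : Plane → R),
      ∃ (F H : MarkedGraph Plane R) (a : Plane),
        D.IsTangleDecomposition T C A B α β F H a) ∧
    (∃ C : D.EulerSystem, ∀ (R : Type u) [CommRing R] (A B : R) (α β : Plane → R)
      (F H : MarkedGraph Plane R) (a : Plane),
        D.IsTangleDecomposition T C A B α β F H a →
          F.NoMarkedNeighbor a ∨ H.NoMarkedNeighbor a) := by
  simp only [LinkDiagram.isTangleDecomposition_iff]
  exact (theorem3_general D).imp (fun h C R _ => h T.inside T.encard_cut_inside_le C R)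
    fun ⟨C, hC⟩ => ⟨C, fun R _ A B α β F H a h => hC R A B α β F H a h.1⟩
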